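/- A linear compartmental model $(G,\mathit{In},\mathit{Out},\mathit{Leak})$ with $n$ compartments consists of a directed graph $G=(V,E)$ without loops on $V=\{1,\dots,n\}$ and subsets $\mathit{In},\mathit{Out},\mathit{Leak}\subseteq V$. It has one real parameter $k_{ij}$ for each edge $j\to i$ in $E$ and one real parameter $k_{0j}$ for each $j\in \mathit{Leak}$. Its compartmental matrix $A$ is the $n\times n$ matrix with $A_{ij}=k_{ij}$ if $j\to i$ is an edge, $A_{ij}=0$ for other $i\neq j$, and $A_{ii}=-\sum_{p:\,i\to p\in E}k_{pi}$, with additional summand $-k_{0i}$ if $i\in \mathit{Leak}$. Its coefficient map $c$ sends a parameter vector in $\mathbb{R}^{|E|+|\mathit{Leak}|}$ to the vector of all non-monic coefficients of the input-output equations $$\det(\partial I-A)\,y_i=\sum_{j\in \mathit{In}}(-1)^{i+j}\det\big((\partial I-A)_{ji}\big)\,u_j\qquad(i\in \mathit{Out}),\qquad \partial=\tfrac{d}{dt},$$ where $(\partial I-A)_{ji}$ is obtained from $\partial I-A$ by removing row $j$ and column $i$. A strongly connected model with at least one input and at least one output is generically locally identifiable if, outside a set of measure zero, every point of $\mathbb{R}^{|E|+|\mathit{Leak}|}$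 has an open neighborhood $U$ such that $c|_U$ is one-to-one. Theorem (Adding edges to cycle model). Let $n\geq 3$. Let $G$ be a graph obtained from the $n$-compartment cycle graph $1\to 2\to\cdots\to n\to 1$ either by adding one incoming edge, that is, an edge $i\to 1$ with $2\leq i\leq n-1$, or by adding one or (if $n\geq 4$) two distinct outgoing edges, that is, edges $1\to j$ with $3\leq j\leq n$. Let $\mathit{In}=\mathit{Out}=\{1\}$ and let $\mathit{Leak}\subseteq\{1,\dots,n\}$ with $|\mathit{Leak}|=1$. Then the model $\widetilde M=(G,\mathit{In},\mathit{Out},\mathit{Leak})$ is generically locally identifiable, and so is the model $M=(G,\mathit{In},\mathit{Out},\emptyset)$ obtained by removing the leak. -/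

import Mathlib

open MeasureTheory

/-- A linear compartmental model `(G, In, Out, Leak)` with `n` compartments, labelled by `Fin n`
(so compartment `1` of the usual labelling is `0 : Fin n`). The directed graph `G` has vertex set
`Fin n` and edge set `edges`; the pair `(j, i)` is the edge `j → i`, and `G` has no loops. -/
structure LinearCompartmentalModel (n : ℕ) where
  edges : Finset (Fin n × Fin n)
  loopless : ∀ i, (i, i) ∉ edges
  inputs : Finset (Fin n)
  outputs : Finset (Fin n)
  leaks : Finset (Fin n)

namespace LinearCompartmentalModel

variable {n : ℕ} (M : LinearCompartmentalModel n)

/-- The parameters of the model: one for each edge and one for each leak. -/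
abbrev Param : Type := ↥M.edges ⊕ ↥M.leaks

/-- The parameter space `ℝ^(|E| + |Leak|)`. -/
abbrev ParamSpace : Type := M.Param → ℝ

/-- The rate constant `k_{ij}` of the edge `j → i` (zero if there is no such edge). -/
def edgeRate (θ : M.ParamSpace) (i j : Fin n) : ℝ :=
  if h : (j, i) ∈ M.edges then θ (Sum.inl ⟨(j, i), h⟩) else 0

/-- The rate constant `k_{0i}` of the leak of compartment `i` (zero if `i` is not a leak). -/
def leakRate (θ : M.ParamSpace) (i : Fin n) : ℝ :=
  if h : i ∈ M.leaks then θ (Sum.inr ⟨i, h⟩) else 0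

/-- The compartmental matrix. -/
def compartmentalMatrix (θ : M.ParamSpace) : Matrix (Fin n) (Fin n) ℝ :=
  Matrix.of fun i j =>
    if i = j then - M.leakRate θ i - ∑ p, M.edgeRate θ p i else M.edgeRate θ i j

/-- The matrix `∂I - A`, over the commutative ring `ℝ[∂]` of differential operators with constant
coefficients; the operator `∂ = d/dt` is the indeterminate of the polynomial ring. -/
noncomputable def operatorMatrix (θ : M.ParamSpace) : Matrix (Fin n) (Fin n) (Polynomial ℝ) :=
  Matrix.scalar (Fin n) (Polynomial.X : Polynomial ℝ) -
    (M.compartmentalMatrix θ).map (Polynomial.C : ℝ →+* Polynomial ℝ)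

/-- The differential operator `det (∂I - A)` acting on the output `y_i` in the input-output
equation `det (∂I - A) y_i = ∑_{j ∈ In} (-1)^(i+j) det ((∂I - A)_{ji}) u_j`. -/
noncomputable def outputOperator (θ : M.ParamSpace) : Polynomial ℝ :=
  (M.operatorMatrix θ).det

/-- The differential operator `(-1)^(i+j) det ((∂I - A)_{ji})` acting on the input `u_j` in the
input-output equation of the output `y_i`, where `(∂I - A)_{ji}` is `∂I - A` without row `j` and
column `i`. This is the `(i, j)` entry of the adjugate; see `inputOperator_eq`. -/
noncomputable def inputOperator (θ : M.ParamSpace) (i j : Fin n) : Polynomial ℝ :=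
  (M.operatorMatrix θ).adjugate i j

theorem inputOperator_eq {m : ℕ} (M : LinearCompartmentalModel (m + 1)) (θ : M.ParamSpace)
    (i j : Fin (m + 1)) :
    M.inputOperator θ i j =
      (-1) ^ ((i : ℕ) + (j : ℕ)) *
        ((M.operatorMatrix θ).submatrix j.succAbove i.succAbove).det := by
  rw [inputOperator, Matrix.adjugate_fin_succ_eq_det_submatrix, add_comm (i : ℕ)]

/-- Index set for the coefficients of the input-output equations: for each output `i`, the
coefficients of `∂^d y_i`, `d < n` (the coefficient of `∂^n y_i` is the leading coefficient `1`),
and, for each output `i` and input `j`, the coefficients of `∂^d u_j`, `d < n`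
(the operator acting on `u_j` has degree less than `n`). -/
abbrev CoeffIndex : Type :=
  (↥M.outputs × Fin n) ⊕ (↥M.outputs × ↥M.inputs × Fin n)

/-- The coefficient map: it sends a parameter vector to the vector of coefficients of the
input-output equations. A coefficient that does not depend on the parameters (identically `0`
or `1`) gives a constant coordinate, which has no influence on where the map is one-to-one. -/
noncomputable def coeffMap (θ : M.ParamSpace) : M.CoeffIndex → ℝ
  | Sum.inl (_, d) => (M.outputOperator θ).coeff d
  | Sum.inr (i, j, d) => (M.inputOperator θ i j).coeff d

/-- There is a directed path from each compartment to every other one. -/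
def StronglyConnected : Prop :=
  ∀ i j : Fin n, Relation.ReflTransGen (fun a b => (a, b) ∈ M.edges) i j

/-- Generic local identifiability, for a strongly connected model with at least one input and at
least one output: outside a set of (Lebesgue) measure zero, every point of the parameter space
has an open neighborhood on which the coefficient map is one-to-one. -/
def GenericallyLocallyIdentifiable : Prop :=
  M.StronglyConnected ∧ M.inputs.Nonempty ∧ M.outputs.Nonempty ∧
    ∃ Z : Set M.ParamSpace, volume Z = 0 ∧
      ∀ θ ∉ Z, ∃ U : Set M.ParamSpace, IsOpen U ∧ θ ∈ U ∧ Set.InjOn M.coeffMap U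

/-- The model obtained by removing all leaks. -/
def removeLeaks : LinearCompartmentalModel n :=
  { M with leaks := ∅ }

end LinearCompartmentalModel

/-- The edges `1 → 2 → ⋯ → n → 1` of the `n`-compartment cycle graph (addition in `Fin n` is
modulo `n`). -/
def cycleEdges (n : ℕ) [NeZero n] : Finset (Fin n × Fin n) :=
  Finset.univ.image fun i => (i, i + 1)

/-- The incoming edges `i → 1`, `2 ≤ i ≤ n - 1`, in the labelling `1, …, n`;
compartment `i` is the element `i - 1` of `Fin n`. -/
def incomingEdges (n : ℕ) [NeZero n] : Finset (Fin n × Fin n) :=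
  Finset.univ.filter fun e => e.2 = 0 ∧ 1 ≤ (e.1 : ℕ) ∧ (e.1 : ℕ) + 1 < n

/-- The outgoing edges `1 → j`, `3 ≤ j ≤ n`, in the labelling `1, …, n`;
compartment `j` is the element `j - 1` of `Fin n`. -/
def outgoingEdges (n : ℕ) [NeZero n] : Finset (Fin n × Fin n) :=
  Finset.univ.filter fun e => e.1 = 0 ∧ 2 ≤ (e.2 : ℕ)

/-!
Write `D i` for the outflow of compartment `i`, so that the diagonal of `∂I - A` is `∂ + D i`, and
number the compartments `0, …, m`. In both families of models the edges that avoid compartment `0`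
form the path `1 → 2 → ⋯ → m`, so the operator acting on the input is the determinant of a
triangular matrix and equals `∏_{i > 0} (∂ + D i)` (`inputOperator_zero_zero`). Where its roots are
distinct they can be told apart locally, so the coefficients determine each `D i`, `i > 0`, locally
(`eq_of_prod_X_add_C_eq`, `genericallyLocallyIdentifiable_of_injective`). No Jacobian is needed.

The operator acting on the output is
`(∂ + D 0) ∏_{i > 0} (∂ + D i) - ∑_γ (product of the rates along γ) ∏_{i not on γ} (∂ + D i)`,
the sum being over the cycles `γ` of the graph, which all pass through `0`
(`outputOperator_of_outgoing`, `outputOperator_of_incoming`). These cycles have pairwise different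
lengths, all at least `2`, so the polynomials `∏_{i not on γ} (∂ + D i)` and `∏_{i > 0} (∂ + D i)`
have pairwise different degrees and are linearly independent: the coefficients determine `D 0` and
the product of the rates along each cycle.

It remains to recover the rates from the outflows and the cycle products. An outflow is the sum of
the rates of the edges leaving the compartment and of its leak rate, so without the leak all but a
few rates of the big cycle are outflows; a single leak hides only one further rate, and that rate
is recovered by elementary algebra (`genericallyLocallyIdentifiable_of_outgoing`,
`genericallyLocallyIdentifiable_of_incoming`). The argument works for any number of outgoing edges
and for at most one leak, which covers both the model and the model without its leak. The
exceptional parameters lie on finitely many hyperplanes: a rate vanishes, two outflows coincide, or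
one of finitely many further linear forms vanishes.
-/

open Polynomial

/-! ### Polynomials, determinants and hyperplanes -/

/-- Polynomials of pairwise distinct degrees are linearly independent. -/
theorem eq_zero_of_sum_C_mul_eq_zero {ι : Type*} [Fintype ι] (P : ι → ℝ[X]) (hP : ∀ i, P i ≠ 0)
    (hdeg : Function.Injective fun i => (P i).degree) (d : ι → ℝ)
    (h : ∑ i, C (d i) * P i = 0) (i : ι) : d i = 0 := by
  have hd : (∑ i, C (d i) * P i).degree
      = Finset.univ.sup fun i => (C (d i) * P i).degree := by
    refine degree_sum_eq_of_disjoint _ _ ?_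
    rintro i ⟨-, hi⟩ j ⟨-, hj⟩ hij hdij
    have hi' : d i ≠ 0 := by rintro h0; simp [h0] at hi
    have hj' : d j ≠ 0 := by rintro h0; simp [h0] at hj
    simp only [Function.comp_apply, degree_C_mul hi', degree_C_mul hj'] at hdij
    exact hij (hdeg hdij)
  rw [h, degree_zero, eq_comm, Finset.sup_eq_bot_iff] at hd
  have := degree_eq_bot.mp (hd i (Finset.mem_univ i))
  simpa [hP i] using this

/-- Two perturbations of a tuple `c` of distinct numbers, each moving every entry by less than half
its distance to the other entries, agree as soon as they agree as multisets of roots. -/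
theorem eq_of_prod_X_add_C_eq {ι : Type*} {s : Finset ι} {c f g : ι → ℝ}
    (hf : ∀ i ∈ s, ∀ j ∈ s, i ≠ j → |f i - c i| < |c i - c j| / 2)
    (hg : ∀ i ∈ s, ∀ j ∈ s, i ≠ j → |g i - c i| < |c i - c j| / 2)
    (h : ∏ i ∈ s, (X + C (f i)) = ∏ i ∈ s, (X + C (g i))) {i : ι} (hi : i ∈ s) : f i = g i := by
  have h0 : ∏ j ∈ s, (-f i + g j) = 0 := by
    have := congrArg (eval (-f i)) h
    simp only [eval_prod, eval_add, eval_X, eval_C] at this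
    rw [← this]
    exact Finset.prod_eq_zero hi (by simp)
  obtain ⟨j, hj, hij⟩ := Finset.prod_eq_zero_iff.mp h0
  by_cases e : i = j
  · subst e; linarith
  · exfalso
    have h1 := hf i hi j hj e
    have h2 := hg j hj i hi (Ne.symm e)
    rw [abs_sub_comm (c j)] at h2
    have h3 : c i - c j = (g j - c j) - (f i - c i) := by linarith
    have h4 := abs_sub (g j - c j) (f i - c i)
    rw [← h3] at h4
    linarith

/-- If `w` is orthogonal to all columns but one and agrees with the adjugate at the corresponding
diagonal entry, it is the row of the adjugate, so its product with that column is `det A`. -/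
theorem Matrix.det_eq_of_vecMul_eq_single {ι R : Type*} [Fintype ι] [DecidableEq ι] [CommRing R]
    [IsDomain R] {A : Matrix ι ι R} {w : ι → R} {k : ι} {d : R}
    (hw : Matrix.vecMul w A = Pi.single k d) (hk : w k = A.adjugate k k) (h0 : w k ≠ 0) :
    A.det = d := by
  have h1 : Matrix.vecMul (Matrix.vecMul w A) A.adjugate = A.det • w := by
    rw [Matrix.vecMul_vecMul, Matrix.mul_adjugate, Matrix.vecMul_smul, Matrix.vecMul_one]
  have h2 := congrFun h1 k
  rw [hw, Matrix.single_vecMul] at h2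
  simp only [Pi.smul_apply, smul_eq_mul, Matrix.row] at h2
  rw [← hk] at h2
  exact (mul_right_cancel₀ h0 h2).symm

theorem Matrix.det_eq_of_mulVec_eq_single {ι R : Type*} [Fintype ι] [DecidableEq ι] [CommRing R]
    [IsDomain R] {A : Matrix ι ι R} {w : ι → R} {k : ι} {d : R}
    (hw : A.mulVec w = Pi.single k d) (hk : w k = A.adjugate k k) (h0 : w k ≠ 0) :
    A.det = d := by
  rw [← Matrix.det_transpose]
  refine Matrix.det_eq_of_vecMul_eq_single (w := w) (k := k) ?_ ?_ h0
  · rw [Matrix.vecMul_transpose, hw]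
  · rw [← Matrix.adjugate_transpose, Matrix.transpose_apply, hk]

theorem volume_linearMap_eq_zero {ι : Type*} [Fintype ι] {L : (ι → ℝ) →ₗ[ℝ] ℝ} (hL : L ≠ 0) :
    volume {θ | L θ = 0} = 0 := by
  have h : LinearMap.ker L ≠ ⊤ := fun h => hL (LinearMap.ker_eq_top.mp h)
  exact Measure.addHaar_submodule volume _ h

theorem eq_of_prod_eq_of_forall_ne {ι : Type*} {s : Finset ι} {f g : ι → ℝ} {k : ι} (hk : k ∈ s)
    (hfg : ∀ i ∈ s, i ≠ k → f i = g i) (hf : ∀ i ∈ s, f i ≠ 0)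
    (h : ∏ i ∈ s, f i = ∏ i ∈ s, g i) : f k = g k := by
  classical
  rw [← Finset.mul_prod_erase s f hk, ← Finset.mul_prod_erase s g hk,
    ← Finset.prod_congr rfl fun i hi =>
      hfg i (Finset.mem_of_mem_erase hi) (Finset.ne_of_mem_erase hi)] at h
  exact mul_right_cancel₀
    (Finset.prod_ne_zero_iff.mpr fun i hi => hf i (Finset.mem_of_mem_erase hi)) h

namespace LinearCompartmentalModel

variable {n : ℕ} (M : LinearCompartmentalModel n)

/-! ### Rates as linear functionals, and genericity -/

/-- `edgeRate` as a linear functional of the parameters. -/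
def edgeRateₗ (i j : Fin n) : M.ParamSpace →ₗ[ℝ] ℝ :=
  if h : (j, i) ∈ M.edges then LinearMap.proj (Sum.inl ⟨(j, i), h⟩) else 0

/-- `leakRate` as a linear functional of the parameters. -/
def leakRateₗ (i : Fin n) : M.ParamSpace →ₗ[ℝ] ℝ :=
  if h : i ∈ M.leaks then LinearMap.proj (Sum.inr ⟨i, h⟩) else 0

theorem edgeRateₗ_apply (i j : Fin n) (θ : M.ParamSpace) :
    M.edgeRateₗ i j θ = M.edgeRate θ i j := by
  unfold edgeRateₗ edgeRate; split_ifs <;> rfl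

theorem leakRateₗ_apply (i : Fin n) (θ : M.ParamSpace) : M.leakRateₗ i θ = M.leakRate θ i := by
  unfold leakRateₗ leakRate; split_ifs <;> rfl

/-- The total rate at which compartment `i` is emptied, through its outgoing edges and its leak:
the negative of the diagonal entry of the compartmental matrix. -/
def outflow (i : Fin n) : M.ParamSpace →ₗ[ℝ] ℝ :=
  M.leakRateₗ i + ∑ p, M.edgeRateₗ p i

theorem outflow_apply (i : Fin n) (θ : M.ParamSpace) :
    M.outflow i θ = M.leakRate θ i + ∑ p, M.edgeRate θ p i := by
  simp [outflow, LinearMap.sum_apply, edgeRateₗ_apply, leakRateₗ_apply]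

variable {M}

theorem edgeRate_eq_zero {θ : M.ParamSpace} {i j : Fin n} (h : (j, i) ∉ M.edges) :
    M.edgeRate θ i j = 0 := dif_neg h

theorem edgeRate_of_mem {θ : M.ParamSpace} {i j : Fin n} (h : (j, i) ∈ M.edges) :
    M.edgeRate θ i j = θ (Sum.inl ⟨(j, i), h⟩) := dif_pos h

theorem leakRate_eq_zero {θ : M.ParamSpace} {i : Fin n} (h : i ∉ M.leaks) :
    M.leakRate θ i = 0 := dif_neg h

theorem edgeRate_ne_zero {θ : M.ParamSpace} (hθ : ∀ p, θ p ≠ 0) {i j : Fin n}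
    (h : (j, i) ∈ M.edges) : M.edgeRate θ i j ≠ 0 := by
  rw [edgeRate_of_mem h]; exact hθ _

theorem edgeRate_single [DecidableEq M.Param] {i j : Fin n} (h : (j, i) ∈ M.edges) (i' j' : Fin n) :
    M.edgeRate (Pi.single (Sum.inl ⟨(j, i), h⟩) 1) i' j' = if j' = j ∧ i' = i then 1 else 0 := by
  unfold edgeRate
  by_cases h' : (j', i') ∈ M.edges
  · simp [h', Pi.single_apply]
  · rw [dif_neg h', if_neg]
    rintro ⟨rfl, rfl⟩
    exact h' h

theorem outflow_single [DecidableEq M.Param] {i j : Fin n} (h : (j, i) ∈ M.edges) (k : Fin n) :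
    M.outflow k (Pi.single (Sum.inl ⟨(j, i), h⟩) 1) = if k = j then 1 else 0 := by
  rw [outflow_apply]
  have : M.leakRate (Pi.single (Sum.inl ⟨(j, i), h⟩) 1) k = 0 := by
    unfold leakRate; split_ifs <;> simp
  simp only [this, edgeRate_single, zero_add]
  by_cases hk : k = j <;> simp [hk]

/-- A parameter vector is determined by its edge rates and its outflows: a leak rate is the part of
the outflow that no edge carries. -/
theorem paramSpace_ext {θ θ' : M.ParamSpace} (h : ∀ i j, M.edgeRate θ i j = M.edgeRate θ' i j)
    (hD : ∀ i, M.outflow i θ = M.outflow i θ') : θ = θ' := by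
  funext p
  rcases p with ⟨⟨j, i⟩, hp⟩ | ⟨i, hi⟩
  · simpa only [edgeRate_of_mem hp] using h i j
  · have := hD i
    simp only [outflow_apply, h, add_left_inj, leakRate, dif_pos hi] at this
    exact this

theorem operatorMatrix_eq (θ : M.ParamSpace) :
    M.operatorMatrix θ = Matrix.diagonal (fun i => X + C (M.outflow i θ)) -
      Matrix.of fun i j => C (M.edgeRate θ i j) := by
  ext1 i j
  by_cases h : i = j
  · subst h
    simp [operatorMatrix, compartmentalMatrix, outflow_apply,
      edgeRate_eq_zero (M.loopless i)]
    ring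
  · simp [operatorMatrix, compartmentalMatrix, h]

variable {m : ℕ} {M : LinearCompartmentalModel (m + 1)}

/-- The operator acting on the input, when the edges that avoid compartment `0` form a path. -/
theorem inputOperator_zero_zero
    (hE : ∀ i j, (i, j) ∈ M.edges → i = 0 ∨ j = 0 ∨ j = i + 1) (θ : M.ParamSpace) :
    M.inputOperator θ 0 0 = ∏ i ∈ Finset.Ioi 0, (X + C (M.outflow i θ)) := by
  rw [inputOperator_eq, operatorMatrix_eq, Matrix.det_of_isLowerTriangular, Fin.prod_Ioi_zero]
  · simp [edgeRate_eq_zero (M.loopless _)]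
  · intro i j hij
    have hij : i < j := hij
    have h : (j.succ, i.succ) ∉ M.edges := by
      intro h
      rcases hE _ _ h with h | h | h
      · simp at h
      · simp at h
      · have := congrArg Fin.val h
        rw [Fin.val_add_eq_ite] at this
        have h1 := i.2
        have h2 := j.2
        have h3 : i.val < j.val := hij
        simp only [Fin.val_succ] at this
        have h4 : ((1 : Fin (m + 1)) : ℕ) = 1 := by
          rw [Fin.val_one']; exact Nat.mod_eq_of_lt (by omega)
        rw [h4] at this
        split_ifs at this <;> omega
    simp [edgeRate_eq_zero h, hij.ne]

/-- Criterion for generic local identifiability. The roots of the operator acting on the input are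
the negatives of the outflows of the compartments other than `0`; for generic parameters they are
distinct, so that locally they can be told apart. Hence the coefficient map only has to be one-to-one
among the parameter vectors with the same such outflows, away from finitely many hyperplanes. -/
theorem genericallyLocallyIdentifiable_of_injective
    (hcyc : ∀ i, (i, i + 1) ∈ M.edges)
    (hE : ∀ i j, (i, j) ∈ M.edges → i = 0 ∨ j = 0 ∨ j = i + 1)
    (hin : M.inputs = {0}) (hout : M.outputs = {0})
    {ι : Type} [Finite ι] (L : ι → M.ParamSpace →ₗ[ℝ] ℝ) (hL : ∀ t, L t ≠ 0)
    (hinj : ∀ θ θ' : M.ParamSpace, (∀ p, θ p ≠ 0) → (∀ p, θ' p ≠ 0) →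
      (∀ t, L t θ ≠ 0) → (∀ t, L t θ' ≠ 0) →
      (∀ i, i ≠ 0 → M.outflow i θ = M.outflow i θ') →
      M.outputOperator θ = M.outputOperator θ' → θ = θ') :
    M.GenericallyLocallyIdentifiable := by
  classical
  have hmem : (0 : Fin (m + 1)) ∈ M.outputs ∧ (0 : Fin (m + 1)) ∈ M.inputs := by
    simp [hin, hout]
  refine ⟨?_, ⟨0, hmem.2⟩, ⟨0, hmem.1⟩, ?_⟩
  · have key : ∀ (k : ℕ) (i : Fin (m + 1)),
        Relation.ReflTransGen (fun a b => (a, b) ∈ M.edges) i (i + Fin.ofNat (m + 1) k) := by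
      intro k i
      induction k with
      | zero => simpa using Relation.ReflTransGen.refl
      | succ k ih =>
        have hk : Fin.ofNat (m + 1) (k + 1) = Fin.ofNat (m + 1) k + 1 := by
          ext; simp [Fin.val_add]
        rw [hk, ← add_assoc]
        exact ih.tail (hcyc _)
    intro i j
    have := key (j - i : Fin (m + 1)).val i
    rwa [Fin.ofNat_val_eq_self, add_sub_cancel] at this
  let V : Set M.ParamSpace := {θ | (∀ p, θ p ≠ 0) ∧ ∀ t, L t θ ≠ 0}
  let W : Set M.ParamSpace := {θ | ∀ i j, i ≠ 0 → i ≠ j → M.outflow i θ - M.outflow j θ ≠ 0}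
  have hcont : ∀ l : M.ParamSpace →ₗ[ℝ] ℝ, Continuous l :=
    fun l => l.continuous_of_finiteDimensional
  have hVopen : IsOpen V := by
    have : V = (⋂ p, {θ | θ p ≠ 0}) ∩ ⋂ t, {θ | L t θ ≠ 0} := by ext; simp [V]
    rw [this]
    exact (isOpen_iInter_of_finite fun p =>
        isOpen_ne_fun (continuous_apply p) continuous_const).inter
      (isOpen_iInter_of_finite fun t => isOpen_ne_fun (hcont _) continuous_const)
  refine ⟨(V ∩ W)ᶜ, ?_, ?_⟩
  · have hsub : (V ∩ W)ᶜ ⊆ (⋃ p, {θ | (LinearMap.proj p : M.ParamSpace →ₗ[ℝ] ℝ) θ = 0}) ∪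
        (⋃ t, {θ | L t θ = 0}) ∪
        ⋃ q : {q : Fin (m + 1) × Fin (m + 1) // q.1 ≠ q.2},
          {θ | (M.outflow q.1.1 - M.outflow q.1.2) θ = 0} := by
      intro θ hθ
      by_contra hcon
      simp only [Set.mem_union, Set.mem_iUnion, Set.mem_ofPred_eq, not_or, not_exists,
        LinearMap.proj_apply, LinearMap.sub_apply] at hcon
      exact hθ ⟨⟨hcon.1.1, hcon.1.2⟩, fun i j _ hij => hcon.2 ⟨(i, j), hij⟩⟩
    refine measure_mono_null hsub (measure_union_null (measure_union_null ?_ ?_) ?_)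
    · refine measure_iUnion_null fun p => volume_linearMap_eq_zero fun h => ?_
      simpa using LinearMap.congr_fun h (Pi.single p 1)
    · have := Finite.to_countable (α := ι)
      exact measure_iUnion_null fun t => volume_linearMap_eq_zero (hL t)
    · refine measure_iUnion_null fun q => volume_linearMap_eq_zero fun h => ?_
      have := LinearMap.congr_fun h (Pi.single (Sum.inl ⟨_, hcyc q.1.1⟩) 1)
      simp [outflow_single, q.2.symm] at this
  · intro θ₀ hθ₀
    obtain ⟨hV, hW⟩ := not_not.mp hθ₀
    let N : Set M.ParamSpace := {θ | ∀ i ∈ Finset.Ioi (0 : Fin (m + 1)),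
      ∀ j ∈ Finset.Ioi (0 : Fin (m + 1)), i ≠ j →
        |M.outflow i θ - M.outflow i θ₀| < |M.outflow i θ₀ - M.outflow j θ₀| / 2}
    have hNopen : IsOpen N := by
      simp only [N, Set.ofPred_forall]
      refine isOpen_iInter_of_finite fun i => isOpen_iInter_of_finite fun _ =>
        isOpen_iInter_of_finite fun j => isOpen_iInter_of_finite fun _ =>
        isOpen_iInter_of_finite fun _ => ?_
      exact isOpen_lt (((hcont _).sub continuous_const).abs) continuous_const
    refine ⟨V ∩ N, hVopen.inter hNopen, ⟨hV, ?_⟩, ?_⟩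
    · intro i hi j _ hij
      rw [sub_self, abs_zero]
      exact half_pos (abs_pos.mpr (hW i j (Finset.mem_Ioi.mp hi).ne' hij))
    · rintro θ ⟨hθ, hθN⟩ θ' ⟨hθ', hθN'⟩ h
      have hlt : ∀ θ : M.ParamSpace, (M.inputOperator θ 0 0).natDegree < m + 1 := by
        intro θ
        rw [inputOperator_zero_zero hE, natDegree_prod_of_monic _ _ fun i _ => monic_X_add_C _]
        simp
      have hinput : M.inputOperator θ 0 0 = M.inputOperator θ' 0 0 := by
        ext d
        by_cases hd : d < m + 1
        · exact congrFun h (Sum.inr (⟨0, hmem.1⟩, ⟨0, hmem.2⟩, ⟨d, hd⟩))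
        · rw [coeff_eq_zero_of_natDegree_lt ((hlt θ).trans_le (not_lt.mp hd)),
            coeff_eq_zero_of_natDegree_lt ((hlt θ').trans_le (not_lt.mp hd))]
      rw [inputOperator_zero_zero hE, inputOperator_zero_zero hE] at hinput
      -- `outputOperator` is the characteristic polynomial of the compartmental matrix
      have hchar : ∀ θ : M.ParamSpace, (M.outputOperator θ).Monic ∧
          (M.outputOperator θ).natDegree = m + 1 := fun θ =>
        ⟨Matrix.charpoly_monic (M.compartmentalMatrix θ),
          (Matrix.charpoly_natDegree_eq_dim (M.compartmentalMatrix θ)).trans (Fintype.card_fin _)⟩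
      have houtput : M.outputOperator θ = M.outputOperator θ' := by
        ext d
        rcases lt_trichotomy d (m + 1) with hd | hd | hd
        · exact congrFun h (Sum.inl (⟨0, hmem.1⟩, ⟨d, hd⟩))
        · have h1 := (hchar θ).1.coeff_natDegree
          have h2 := (hchar θ').1.coeff_natDegree
          rw [(hchar θ).2] at h1
          rw [(hchar θ').2] at h2
          rw [hd, h1, h2]
        · rw [coeff_eq_zero_of_natDegree_lt ((hchar θ).2.trans_lt hd),
            coeff_eq_zero_of_natDegree_lt ((hchar θ').2.trans_lt hd)]
      refine hinj θ θ' hθ.1 hθ'.1 hθ.2 hθ'.2 (fun i hi => ?_) houtput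
      exact eq_of_prod_X_add_C_eq hθN hθN' hinput (Finset.mem_Ioi.mpr (Fin.pos_of_ne_zero hi))

/-! ### Added edges out of compartment `0` -/

section Outgoing

/-- The product of the rates along the path `j → j + 1 → ⋯ → m → 0`, for `j ≠ 0`, and `1` for
`j = 0`. -/
def rateToZero (θ : M.ParamSpace) (j : Fin (m + 1)) : ℝ :=
  if j = 0 then 1 else ∏ i ∈ Finset.Ici j, M.edgeRate θ (i + 1) i

/-- The product of the characteristic factors of the compartments other than `0` off the path
`j → j + 1 → ⋯ → m → 0`; for `j = 0`, of all compartments other than `0`. -/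
noncomputable def factorsOffPathToZero (θ : M.ParamSpace) (j : Fin (m + 1)) : ℝ[X] :=
  if j = 0 then ∏ i ∈ Finset.Ioi 0, (X + C (M.outflow i θ))
  else ∏ i ∈ Finset.Ioo 0 j, (X + C (M.outflow i θ))

/-- The recursion that makes column `j` of `∂I - A` orthogonal to the row vector with entries
`rateToZero θ j * factorsOffPathToZero θ j`. For `j = m`, `j + 1` is compartment `0`. -/
theorem rateToZero_mul_factors_step (θ : M.ParamSpace) {j : Fin (m + 1)} (hj : j ≠ 0) :
    C (rateToZero θ j) * factorsOffPathToZero θ j * (X + C (M.outflow j θ)) =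
      C (rateToZero θ (j + 1)) * factorsOffPathToZero θ (j + 1) * C (M.edgeRate θ (j + 1) j) := by
  by_cases hl : j = Fin.last m
  · subst hl
    have h1 : Finset.Ici (Fin.last m) = {Fin.last m} := by
      ext i; simp [Fin.last_le_iff]
    have h2 : Finset.Ioi (0 : Fin (m + 1)) = insert (Fin.last m)
        (Finset.Ioo 0 (Fin.last m)) := by
      ext i
      have h0 := Fin.pos_of_ne_zero hj
      have := i.2
      simp only [Finset.mem_Ioi, Finset.mem_insert, Finset.mem_Ioo, Fin.ext_iff, Fin.lt_def,
        Fin.val_last, Fin.val_zero] at h0 ⊢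
      omega
    simp only [rateToZero, factorsOffPathToZero, if_neg hj, Fin.last_add_one, if_true, h1, h2]
    rw [Finset.prod_insert (by simp), Finset.prod_singleton, map_one, Fin.last_add_one]
    ring
  · have hv : ((j + 1 : Fin (m + 1)) : ℕ) = j + 1 :=
      Fin.val_add_one_of_lt (Fin.lt_last_iff_ne_last.mpr hl)
    have hj1 : j + 1 ≠ 0 := fun h => by simp [h] at hv
    have h1 : Finset.Ici j = insert j (Finset.Ici (j + 1)) := by
      ext i
      simp only [Finset.mem_Ici, Finset.mem_insert, Fin.ext_iff, Fin.le_def, hv]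
      omega
    have h2 : Finset.Ioo 0 (j + 1) = insert j (Finset.Ioo 0 j) := by
      have := Fin.pos_of_ne_zero hj
      ext i
      simp only [Finset.mem_Ioo, Finset.mem_insert, Fin.ext_iff, Fin.lt_def, hv] at this ⊢
      omega
    simp only [rateToZero, factorsOffPathToZero, if_neg hj, if_neg hj1, h1, h2]
    rw [Finset.prod_insert (by simp [hl]), Finset.prod_insert (by simp), C_mul]
    ring

theorem outputOperator_of_outgoing (hE : ∀ i j, (i, j) ∈ M.edges → i = 0 ∨ j = i + 1)
    (θ : M.ParamSpace) :
    M.outputOperator θ = (X + C (M.outflow 0 θ)) * factorsOffPathToZero θ 0 -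
      ∑ j, C (M.edgeRate θ j 0 * rateToZero θ j) * factorsOffPathToZero θ j := by
  have h0 : factorsOffPathToZero θ 0 = ∏ i ∈ Finset.Ioi 0, (X + C (M.outflow i θ)) := if_pos rfl
  have h1 : rateToZero θ 0 = 1 := if_pos rfl
  refine Matrix.det_eq_of_vecMul_eq_single (k := 0)
    (w := fun j => C (rateToZero θ j) * factorsOffPathToZero θ j) ?_ ?_ ?_
  · rw [operatorMatrix_eq, Matrix.vecMul_sub]
    ext1 j
    rw [Pi.sub_apply, Matrix.vecMul_diagonal]
    by_cases hj : j = 0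
    · subst hj
      rw [Pi.single_eq_same]
      simp only [Matrix.vecMul, dotProduct, Matrix.of_apply, C_mul]
      refine congrArg₂ (· - ·) ?_ (Finset.sum_congr rfl fun i _ => by ring)
      rw [h1, map_one, one_mul, mul_comm]
    · rw [Pi.single_eq_of_ne hj]
      simp only [Matrix.vecMul, dotProduct, Matrix.of_apply]
      -- the only edge out of `j` goes to `j + 1`
      rw [Finset.sum_eq_single (j + 1)]
      · rw [rateToZero_mul_factors_step θ hj, sub_self]
      · intro i _ hi
        rw [edgeRate_eq_zero, map_zero, mul_zero]
        intro h
        exact (hE _ _ h).elim hj hi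
      · simp
  · have h := inputOperator_zero_zero (fun i j h => (hE i j h).imp_right Or.inr) θ
    rw [h1, map_one, one_mul]
    exact h0.trans h.symm
  · rw [h1, map_one, one_mul]
    rw [h0]
    exact (monic_prod_of_monic _ _ fun i _ => monic_X_add_C _).ne_zero

/-- Equality of the operators acting on the output, compared in the basis given by
`factorsOffPathToZero`, whose members have distinct degrees. -/
theorem eq_of_outputOperator_eq_of_outgoing
    (hE : ∀ i j, (i, j) ∈ M.edges → i = 0 ∨ j = i + 1) {θ θ' : M.ParamSpace}
    (hD : ∀ i, i ≠ 0 → M.outflow i θ = M.outflow i θ')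
    (h : M.outputOperator θ = M.outputOperator θ') :
    M.outflow 0 θ = M.outflow 0 θ' ∧
      ∀ j, M.edgeRate θ j 0 * rateToZero θ j = M.edgeRate θ' j 0 * rateToZero θ' j := by
  have hP : factorsOffPathToZero θ' = factorsOffPathToZero θ := by
    funext j
    unfold factorsOffPathToZero
    split_ifs
    · exact Finset.prod_congr rfl fun i hi => by rw [hD i (Finset.mem_Ioi.mp hi).ne']
    · exact Finset.prod_congr rfl fun i hi => by rw [hD i (Finset.mem_Ioo.mp hi).1.ne']
  rw [outputOperator_of_outgoing hE, outputOperator_of_outgoing hE, hP, ← sub_eq_zero] at h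
  have hmonic : ∀ j, (factorsOffPathToZero θ j).Monic := by
    intro j
    unfold factorsOffPathToZero
    split_ifs <;> exact monic_prod_of_monic _ _ fun i _ => monic_X_add_C _
  have hdeg : ∀ j, (factorsOffPathToZero θ j).natDegree = if j = 0 then m else (j : ℕ) - 1 := by
    intro j
    unfold factorsOffPathToZero
    split_ifs <;>
    · rw [natDegree_prod_of_monic _ _ fun i _ => monic_X_add_C _]
      simp
  have hself : ∀ θ : M.ParamSpace, M.edgeRate θ 0 0 = 0 := fun θ => edgeRate_eq_zero (M.loopless 0)
  -- index `0` is free for the outflow of compartment `0`, since there is no edge `0 → 0`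
  let d : Fin (m + 1) → ℝ := fun j =>
    (if j = 0 then M.outflow 0 θ - M.outflow 0 θ' else 0) -
      (M.edgeRate θ j 0 * rateToZero θ j - M.edgeRate θ' j 0 * rateToZero θ' j)
  have hd := eq_zero_of_sum_C_mul_eq_zero (factorsOffPathToZero θ) (fun j => (hmonic j).ne_zero)
    (fun i j hij => by
      have hij := natDegree_eq_of_degree_eq hij
      simp only [hdeg] at hij
      have := i.2
      have := j.2
      ext
      split_ifs at hij with hi hj hj <;> simp only [Fin.ext_iff, Fin.val_zero] at hi hj <;> omega)
    d (by
      rw [← h]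
      simp only [d, C_sub, sub_mul, Finset.sum_sub_distrib, add_mul]
      simp [apply_ite C, ite_mul, sub_mul]
      ring)
  have hd0 := hd 0
  simp only [d, if_true, hself, zero_mul, sub_zero] at hd0
  refine ⟨sub_eq_zero.mp hd0, fun j => ?_⟩
  by_cases hj : j = 0
  · subst hj; simp [hself]
  · have hdj := hd j
    simp only [d, if_neg hj, zero_sub, neg_eq_zero] at hdj
    exact sub_eq_zero.mp hdj

end Outgoing

/-! ### Added edges into compartment `0` -/

section Incoming

/-- The product of the characteristic factors of the compartments off the path
`0 → 1 → ⋯ → j`. -/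
noncomputable def factorsOffPathFromZero (θ : M.ParamSpace) (j : Fin (m + 1)) : ℝ[X] :=
  ∏ i ∈ Finset.Ioi j, (X + C (M.outflow i θ))

/-- The product of the rates along the path `0 → 1 → ⋯ → j`. -/
def rateFromZero (θ : M.ParamSpace) (j : Fin (m + 1)) : ℝ :=
  ∏ i ∈ Finset.Iio j, M.edgeRate θ (i + 1) i

/-- The recursion that makes row `k + 1` of `∂I - A` orthogonal to the column vector with entries
`rateFromZero θ j * factorsOffPathFromZero θ j`. -/
theorem rateFromZero_mul_factors_step (θ : M.ParamSpace) {k : Fin (m + 1)} (hj : k + 1 ≠ 0) :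
    (X + C (M.outflow (k + 1) θ)) * (C (rateFromZero θ (k + 1)) * factorsOffPathFromZero θ (k + 1)) =
      C (M.edgeRate θ (k + 1) k) * (C (rateFromZero θ k) * factorsOffPathFromZero θ k) := by
  have hl : k ≠ Fin.last m := by rintro rfl; simp at hj
  have hv : ((k + 1 : Fin (m + 1)) : ℕ) = k + 1 :=
    Fin.val_add_one_of_lt (Fin.lt_last_iff_ne_last.mpr hl)
  have h1 : Finset.Iio (k + 1) = insert k (Finset.Iio k) := by
    ext i
    simp only [Finset.mem_Iio, Finset.mem_insert, Fin.ext_iff, Fin.lt_def, hv]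
    omega
  have h2 : Finset.Ioi k = insert (k + 1) (Finset.Ioi (k + 1)) := by
    ext i
    simp only [Finset.mem_Ioi, Finset.mem_insert, Fin.ext_iff, Fin.lt_def, hv]
    omega
  simp only [rateFromZero, factorsOffPathFromZero, h1, h2]
  rw [Finset.prod_insert (by simp), Finset.prod_insert (by simp), C_mul]
  ring

theorem outputOperator_of_incoming (hE : ∀ i j, (i, j) ∈ M.edges → j = 0 ∨ j = i + 1)
    (θ : M.ParamSpace) :
    M.outputOperator θ = (X + C (M.outflow 0 θ)) * factorsOffPathFromZero θ 0 -
      ∑ j, C (M.edgeRate θ 0 j * rateFromZero θ j) * factorsOffPathFromZero θ j := by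
  have hw0 : rateFromZero θ 0 = 1 := by
    have : Finset.Iio (0 : Fin (m + 1)) = ∅ := by ext; simp
    simp [rateFromZero, this]
  refine Matrix.det_eq_of_mulVec_eq_single (k := 0)
    (w := fun j => C (rateFromZero θ j) * factorsOffPathFromZero θ j) ?_ ?_ ?_
  · rw [operatorMatrix_eq, Matrix.sub_mulVec]
    ext1 j
    rw [Pi.sub_apply, Matrix.mulVec_diagonal]
    by_cases hj : j = 0
    · subst hj
      rw [Pi.single_eq_same]
      simp only [Matrix.mulVec, dotProduct, Matrix.of_apply, C_mul]
      refine congrArg₂ (· - ·) ?_ (Finset.sum_congr rfl fun i _ => by ring)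
      rw [hw0, map_one, one_mul]
    · rw [Pi.single_eq_of_ne hj]
      simp only [Matrix.mulVec, dotProduct, Matrix.of_apply]
      obtain ⟨k, rfl⟩ : ∃ k, j = k + 1 := ⟨j - 1, by simp⟩
      -- the only edge into `k + 1` comes from `k`
      rw [Finset.sum_eq_single k]
      · rw [rateFromZero_mul_factors_step θ hj, sub_self]
      · intro i _ hi
        rw [edgeRate_eq_zero, map_zero, zero_mul]
        intro h
        exact (hE _ _ h).elim hj fun h => hi (add_right_cancel h).symm
      · simp
  · have h := inputOperator_zero_zero (fun i j h => Or.inr (hE i j h)) θ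
    rw [hw0, map_one, one_mul]
    exact h.symm
  · rw [hw0, map_one, one_mul]
    exact (monic_prod_of_monic _ _ fun i _ => monic_X_add_C _).ne_zero

/-- Equality of the operators acting on the output, compared in the basis given by
`factorsOffPathFromZero`, whose members have distinct degrees. -/
theorem eq_of_outputOperator_eq_of_incoming
    (hE : ∀ i j, (i, j) ∈ M.edges → j = 0 ∨ j = i + 1) {θ θ' : M.ParamSpace}
    (hD : ∀ i, i ≠ 0 → M.outflow i θ = M.outflow i θ')
    (h : M.outputOperator θ = M.outputOperator θ') :
    M.outflow 0 θ = M.outflow 0 θ' ∧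
      ∀ j, M.edgeRate θ 0 j * rateFromZero θ j = M.edgeRate θ' 0 j * rateFromZero θ' j := by
  have hP : factorsOffPathFromZero θ' = factorsOffPathFromZero θ := by
    funext j
    exact Finset.prod_congr rfl fun i hi => by
      rw [hD i ((Fin.zero_le j).trans_lt (Finset.mem_Ioi.mp hi)).ne']
  rw [outputOperator_of_incoming hE, outputOperator_of_incoming hE, hP, ← sub_eq_zero] at h
  have hself : ∀ θ : M.ParamSpace, M.edgeRate θ 0 0 = 0 := fun θ => edgeRate_eq_zero (M.loopless 0)
  -- index `0` is free for the outflow of compartment `0`, since there is no edge `0 → 0`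
  let d : Fin (m + 1) → ℝ := fun j =>
    (if j = 0 then M.outflow 0 θ - M.outflow 0 θ' else 0) -
      (M.edgeRate θ 0 j * rateFromZero θ j - M.edgeRate θ' 0 j * rateFromZero θ' j)
  have hd := eq_zero_of_sum_C_mul_eq_zero (factorsOffPathFromZero θ)
    (fun j => (monic_prod_of_monic _ _ fun i _ => monic_X_add_C _).ne_zero)
    (fun i j hij => by
      have hij := natDegree_eq_of_degree_eq hij
      simp only [factorsOffPathFromZero,
        natDegree_prod_of_monic _ _ fun i _ => monic_X_add_C (M.outflow i θ)] at hij
      simp at hij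
      have := i.2
      have := j.2
      ext
      omega)
    d (by
      rw [← h]
      simp only [d, C_sub, sub_mul, Finset.sum_sub_distrib, add_mul]
      simp [apply_ite C, ite_mul, sub_mul]
      ring)
  have hd0 := hd 0
  simp only [d, if_true, hself, zero_mul, sub_zero] at hd0
  refine ⟨sub_eq_zero.mp hd0, fun j => ?_⟩
  by_cases hj : j = 0
  · subst hj; simp [hself]
  · have hdj := hd j
    simp only [d, if_neg hj, zero_sub, neg_eq_zero] at hdj
    exact sub_eq_zero.mp hdj

end Incoming

/-! ### Identifiability -/

theorem exists_forall_ne_leakRate_eq_zero (hleak : M.leaks.card ≤ 1) :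
    ∃ l, ∀ i, i ≠ l → ∀ θ : M.ParamSpace, M.leakRate θ i = 0 := by
  obtain ⟨l, hl⟩ := Finset.card_le_one_iff_subset_singleton.mp hleak
  exact ⟨l, fun i hi θ => leakRate_eq_zero fun h => hi (Finset.mem_singleton.mp (hl h))⟩

/-- The case of outgoing edges. With the leak at `l ≠ 0`, the rate of `l → l + 1` is the only one
of the cycle beyond `0` that the outflows do not give. Its product with the sum of the rates of the
edges `0 → j`, `j ≤ l`, is known, and so is this sum, from the outflow of `0` and the rates of the
edges `0 → j`, `j > l`. -/
theorem genericallyLocallyIdentifiable_of_outgoing (hcyc : ∀ i, (i, i + 1) ∈ M.edges)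
    (hE : ∀ i j, (i, j) ∈ M.edges → i = 0 ∨ j = i + 1)
    (hin : M.inputs = {0}) (hout : M.outputs = {0}) (hleak : M.leaks.card ≤ 1) :
    M.GenericallyLocallyIdentifiable := by
  classical
  refine genericallyLocallyIdentifiable_of_injective hcyc
    (fun i j h => (hE i j h).imp_right Or.inr) hin hout
    (ι := {l : Fin (m + 1) // l ≠ 0})
    (fun l => ∑ j ∈ Finset.univ.filter (· ≤ l.1), M.edgeRateₗ j 0) ?_ ?_
  · rintro ⟨l, hl⟩ h
    have := LinearMap.congr_fun h (Pi.single (Sum.inl ⟨_, hcyc 0⟩) 1)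
    have h1 : (0 : Fin (m + 1)) + 1 ≤ l := by
      rw [zero_add]; exact Fin.one_le_of_ne_zero hl
    simp only [LinearMap.sum_apply, edgeRateₗ_apply, edgeRate_single, true_and,
      LinearMap.zero_apply, Finset.sum_ite_eq', Finset.mem_filter, Finset.mem_univ, h1,
      if_true] at this
    exact one_ne_zero this
  intro θ θ' hθ hθ' hL hL' hD hdet
  obtain ⟨hD0, hκ⟩ := eq_of_outputOperator_eq_of_outgoing hE hD hdet
  obtain ⟨l, hl⟩ := exists_forall_ne_leakRate_eq_zero hleak
  have hflow : ∀ (θ : M.ParamSpace) (i), i ≠ 0 → i ≠ l →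
      M.outflow i θ = M.edgeRate θ (i + 1) i := by
    intro θ i hi hil
    rw [outflow_apply, hl i hil, zero_add]
    exact Finset.sum_eq_single _ (fun p _ hp => edgeRate_eq_zero fun h => (hE _ _ h).elim hi hp)
      (by simp)
  have hne : ∀ {θ : M.ParamSpace}, (∀ p, θ p ≠ 0) → ∀ j, rateToZero θ j ≠ 0 := by
    intro θ hθ j
    unfold rateToZero
    split_ifs
    · exact one_ne_zero
    · exact Finset.prod_ne_zero_iff.mpr fun i _ => edgeRate_ne_zero hθ (hcyc i)
  have hcycle : ∀ i, i ≠ 0 → i ≠ l → M.edgeRate θ (i + 1) i = M.edgeRate θ' (i + 1) i := by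
    intro i hi hil
    rw [← hflow θ i hi hil, ← hflow θ' i hi hil, hD i hi]
  have hcycle_l : l ≠ 0 → M.edgeRate θ (l + 1) l = M.edgeRate θ' (l + 1) l := by
    intro hl0
    have hgt : ∀ j, ¬ j ≤ l → M.edgeRate θ j 0 = M.edgeRate θ' j 0 := by
      intro j hj
      have h := hκ j
      have hr : rateToZero θ j = rateToZero θ' j := by
        unfold rateToZero
        split_ifs with hj0
        · rfl
        · refine Finset.prod_congr rfl fun i hi => ?_
          have hji := Finset.mem_Ici.mp hi
          exact hcycle i (fun h => hj0 (by simpa [h] using hji))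
            (fun h => hj (h ▸ hji))
      rw [hr] at h
      exact mul_right_cancel₀ (hne hθ' j) h
    have hle : ∀ j ∈ Finset.univ.filter (· ≤ l),
        M.edgeRate θ j 0 * M.edgeRate θ (l + 1) l = M.edgeRate θ' j 0 * M.edgeRate θ' (l + 1) l := by
      intro j hj
      have hj : j ≤ l := (Finset.mem_filter.mp hj).2
      by_cases hj0 : j = 0
      · subst hj0
        simp [edgeRate_eq_zero (M.loopless 0)]
      · have h := hκ j
        have hmem : l ∈ Finset.Ici j := Finset.mem_Ici.mpr hj
        have herase : ∏ i ∈ (Finset.Ici j).erase l, M.edgeRate θ (i + 1) i =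
            ∏ i ∈ (Finset.Ici j).erase l, M.edgeRate θ' (i + 1) i := by
          refine Finset.prod_congr rfl fun i hi => ?_
          have hji := Finset.mem_Ici.mp (Finset.mem_of_mem_erase hi)
          exact hcycle i (fun h => hj0 (by simpa [h] using hji)) (Finset.ne_of_mem_erase hi)
        simp only [rateToZero, if_neg hj0, ← Finset.mul_prod_erase _ _ hmem, ← mul_assoc] at h
        rw [herase] at h
        exact mul_right_cancel₀
          (Finset.prod_ne_zero_iff.mpr fun i _ => edgeRate_ne_zero hθ' (hcyc i)) h
    have hS : ∑ j ∈ Finset.univ.filter (· ≤ l), M.edgeRate θ j 0 =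
        ∑ j ∈ Finset.univ.filter (· ≤ l), M.edgeRate θ' j 0 := by
      have h := hD0
      simp only [outflow_apply, hl 0 hl0.symm, zero_add] at h
      rw [← Finset.sum_filter_add_sum_filter_not _ (· ≤ l),
        ← Finset.sum_filter_add_sum_filter_not (f := fun j => M.edgeRate θ' j 0) _ (· ≤ l),
        Finset.sum_congr rfl fun j hj => hgt j (Finset.mem_filter.mp hj).2] at h
      exact add_right_cancel h
    have hmul := Finset.sum_congr rfl hle
    rw [← Finset.sum_mul, ← Finset.sum_mul, hS] at hmul
    have hL' := hL' ⟨l, hl0⟩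
    simp only [LinearMap.sum_apply, edgeRateₗ_apply] at hL'
    exact mul_left_cancel₀ hL' hmul
  have hcycle' : ∀ i, i ≠ 0 → M.edgeRate θ (i + 1) i = M.edgeRate θ' (i + 1) i := by
    intro i hi
    by_cases hil : i = l
    · subst hil; exact hcycle_l hi
    · exact hcycle i hi hil
  refine paramSpace_ext (fun i j => ?_) fun i => ?_
  · by_cases hj : j = 0
    · subst hj
      have h := hκ i
      have hr : rateToZero θ i = rateToZero θ' i := by
        unfold rateToZero
        split_ifs with hi0
        · rfl
        · exact Finset.prod_congr rfl fun k hk => hcycle' k fun h =>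
            hi0 (by simpa [h] using Finset.mem_Ici.mp hk)
      rw [hr] at h
      exact mul_right_cancel₀ (hne hθ' i) h
    · by_cases hij : i = j + 1
      · subst hij; exact hcycle' j hj
      · have h : (j, i) ∉ M.edges := fun h => (hE _ _ h).elim hj hij
        rw [edgeRate_eq_zero h, edgeRate_eq_zero h]
  · by_cases hi : i = 0
    · subst hi; exact hD0
    · exact hD i hi

/-- The case of one incoming edge `s → 0`. Let `p` be the product of the rates along `0 → ⋯ → s`,
and `b` and `a` the rates of `s → 0` and `s → s + 1`. The products of the rates along the two
cycles are known, and so is the outflow of `s`, which is `a + b` unless the leak is at `s`. If the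
leak is at `l < s`, then `p a` and `p b` are known, hence `p`; if it is at `l ≥ s`, then
`l` does not contribute to `p` and `b` is known first. -/
theorem genericallyLocallyIdentifiable_of_incoming (hcyc : ∀ i, (i, i + 1) ∈ M.edges)
    {s : Fin (m + 1)} (hs : s + 1 ≠ 0) (hsE : (s, 0) ∈ M.edges)
    (hE : ∀ i j, (i, j) ∈ M.edges → (i = s ∧ j = 0) ∨ j = i + 1)
    (hin : M.inputs = {0}) (hout : M.outputs = {0}) (hleak : M.leaks.card ≤ 1) :
    M.GenericallyLocallyIdentifiable := by
  classical
  have hE' : ∀ i j, (i, j) ∈ M.edges → j = 0 ∨ j = i + 1 :=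
    fun i j h => (hE i j h).imp_left And.right
  refine genericallyLocallyIdentifiable_of_injective hcyc
    (fun i j h => Or.inr (hE' i j h)) hin hout (ι := Unit) (fun _ => M.outflow s) ?_ ?_
  · intro _ h
    have := LinearMap.congr_fun h (Pi.single (Sum.inl ⟨_, hsE⟩) 1)
    simp [outflow_single] at this
  intro θ θ' hθ hθ' hL hL' hD hdet
  obtain ⟨hD0, hκ⟩ := eq_of_outputOperator_eq_of_incoming hE' hD hdet
  obtain ⟨l, hl⟩ := exists_forall_ne_leakRate_eq_zero hleak
  have hD : ∀ i, M.outflow i θ = M.outflow i θ' := by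
    intro i
    by_cases hi : i = 0
    · subst hi; exact hD0
    · exact hD i hi
  have hflow : ∀ (θ : M.ParamSpace) (i), i ≠ s → i ≠ l →
      M.outflow i θ = M.edgeRate θ (i + 1) i := by
    intro θ i hi hil
    rw [outflow_apply, hl i hil, zero_add]
    exact Finset.sum_eq_single _
      (fun p _ hp => edgeRate_eq_zero fun h => (hE _ _ h).elim (fun h => hi h.1) hp) (by simp)
  have hflow_s : ∀ θ : M.ParamSpace, s ≠ l →
      M.outflow s θ = M.edgeRate θ (s + 1) s + M.edgeRate θ 0 s := by
    intro θ hsl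
    rw [outflow_apply, hl s hsl, zero_add]
    refine Fintype.sum_eq_add _ _ hs fun p hp => edgeRate_eq_zero fun h => ?_
    exact (hE _ _ h).elim (fun h => hp.2 h.2) hp.1
  have hne : ∀ {θ : M.ParamSpace}, (∀ p, θ p ≠ 0) → ∀ i, M.edgeRate θ (i + 1) i ≠ 0 :=
    fun hθ i => edgeRate_ne_zero hθ (hcyc i)
  have hcycle : ∀ i, i ≠ s → i ≠ l → M.edgeRate θ (i + 1) i = M.edgeRate θ' (i + 1) i := by
    intro i hi hil
    rw [← hflow θ i hi hil, ← hflow θ' i hi hil, hD i]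
  have hsplit : ∀ θ : M.ParamSpace, ∏ i, M.edgeRate θ (i + 1) i =
      rateFromZero θ s * (M.edgeRate θ (s + 1) s * ∏ i ∈ Finset.Ioi s, M.edgeRate θ (i + 1) i) := by
    intro θ
    have h1 : (Finset.univ.filter (¬ · < s)) = insert s (Finset.Ioi s) := by
      ext i; simp [le_iff_eq_or_lt]
    have h2 : (Finset.univ.filter (· < s)) = Finset.Iio s := by ext; simp
    rw [← Finset.prod_filter_mul_prod_filter_not _ (· < s), h1, h2,
      Finset.prod_insert (by simp), rateFromZero]
  -- the coefficient at `j = m` is the product along the whole cycle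
  have hprod : ∏ i, M.edgeRate θ (i + 1) i = ∏ i, M.edgeRate θ' (i + 1) i := by
    have hlast : ∀ θ : M.ParamSpace, ∏ i, M.edgeRate θ (i + 1) i =
        M.edgeRate θ 0 (Fin.last m) * rateFromZero θ (Fin.last m) := by
      intro θ
      have h1 : (Finset.univ : Finset (Fin (m + 1))).erase (Fin.last m)
          = Finset.Iio (Fin.last m) := by
        ext i
        rw [Finset.mem_Iio, Fin.lt_last_iff_ne_last]
        simp
      rw [← Finset.mul_prod_erase _ _ (Finset.mem_univ (Fin.last m)), h1, Fin.last_add_one,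
        rateFromZero]
    rw [hlast, hlast, hκ]
  have hp : ∀ {θ : M.ParamSpace}, (∀ p, θ p ≠ 0) → rateFromZero θ s ≠ 0 := fun hθ =>
    Finset.prod_ne_zero_iff.mpr fun i _ => hne hθ i
  have hκs := hκ s
  -- Once the product along `0 → ⋯ → s` and, for `s ≠ l`, the rate of `s → s + 1` are known, the only
  -- rate missing from the cycle is that at `l`, and the product along the whole cycle gives it.
  have hfinish : rateFromZero θ s = rateFromZero θ' s →
      (s ≠ l → M.edgeRate θ (s + 1) s = M.edgeRate θ' (s + 1) s) → θ = θ' := by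
    intro hps has
    have hb : M.edgeRate θ 0 s = M.edgeRate θ' 0 s := by
      rw [hps] at hκs
      exact mul_right_cancel₀ (hp hθ') hκs
    have hcycle' : ∀ i, i ≠ l → M.edgeRate θ (i + 1) i = M.edgeRate θ' (i + 1) i := by
      intro i hil
      by_cases his : i = s
      · subst his; exact has hil
      · exact hcycle i his hil
    have hcycle_l : M.edgeRate θ (l + 1) l = M.edgeRate θ' (l + 1) l :=
      eq_of_prod_eq_of_forall_ne (f := fun i => M.edgeRate θ (i + 1) i)
        (g := fun i => M.edgeRate θ' (i + 1) i) (Finset.mem_univ l)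
        (fun i _ hi => hcycle' i hi) (fun i _ => hne hθ i) hprod
    refine paramSpace_ext (fun i j => ?_) hD
    by_cases hij : i = j + 1
    · subst hij
      by_cases hj : j = l
      · subst hj; exact hcycle_l
      · exact hcycle' j hj
    · by_cases h : j = s ∧ i = 0
      · rw [h.1, h.2]; exact hb
      · have h : (j, i) ∉ M.edges := fun h' => (hE _ _ h').elim h hij
        rw [edgeRate_eq_zero h, edgeRate_eq_zero h]
  rw [hsplit, hsplit] at hprod
  rcases lt_or_ge l s with hls | hls
  · have hq : ∏ i ∈ Finset.Ioi s, M.edgeRate θ (i + 1) i =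
        ∏ i ∈ Finset.Ioi s, M.edgeRate θ' (i + 1) i :=
      Finset.prod_congr rfl fun i hi =>
        have hi := Finset.mem_Ioi.mp hi
        hcycle i hi.ne' (hls.trans hi).ne'
    rw [hq, ← mul_assoc, ← mul_assoc] at hprod
    have hpa := mul_right_cancel₀ (Finset.prod_ne_zero_iff.mpr fun i _ => hne hθ' i) hprod
    have hDs := hD s
    have hL' := hL' ()
    rw [hflow_s θ hls.ne', hflow_s θ' hls.ne'] at hDs
    rw [hflow_s θ' hls.ne'] at hL'
    have hps : rateFromZero θ s = rateFromZero θ' s := by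
      refine mul_right_cancel₀ hL' ?_
      rw [← hDs, mul_add, hpa, mul_comm _ (M.edgeRate θ 0 s), hκs, hDs]
      ring
    rw [hps] at hpa
    exact hfinish hps fun _ => mul_left_cancel₀ (hp hθ') hpa
  · have hps : rateFromZero θ s = rateFromZero θ' s :=
      Finset.prod_congr rfl fun i hi =>
        have hi := Finset.mem_Iio.mp hi
        hcycle i hi.ne (hi.trans_le hls).ne
    refine hfinish hps fun hsl => ?_
    rw [hps] at hκs
    have hDs := hD s
    rw [hflow_s θ hsl, hflow_s θ' hsl, mul_right_cancel₀ (hp hθ') hκs] at hDs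
    exact add_right_cancel hDs

/-- Adding edges to the cycle: the two cases together, with at most one leak. -/
theorem genericallyLocallyIdentifiable_of_cycle_union {n : ℕ} [NeZero n]
    {added : Finset (Fin n × Fin n)}
    (hadded : (added ⊆ incomingEdges n ∧ added.card = 1) ∨ added ⊆ outgoingEdges n)
    {M : LinearCompartmentalModel n} (hedges : M.edges = cycleEdges n ∪ added)
    (hin : M.inputs = {0}) (hout : M.outputs = {0}) (hleak : M.leaks.card ≤ 1) :
    M.GenericallyLocallyIdentifiable := by
  obtain ⟨m, rfl⟩ := Nat.exists_eq_succ_of_ne_zero (NeZero.ne n)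
  have hcyc : ∀ i, (i, i + 1) ∈ M.edges := by
    intro i
    rw [hedges]
    exact Finset.mem_union_left _ (Finset.mem_image_of_mem _ (Finset.mem_univ i))
  have hE : ∀ i j, (i, j) ∈ M.edges → (i, j) ∈ added ∨ j = i + 1 := by
    intro i j h
    rw [hedges, Finset.mem_union] at h
    refine h.symm.imp_right fun h => ?_
    obtain ⟨k, -, hk⟩ := Finset.mem_image.mp h
    obtain ⟨rfl, rfl⟩ := Prod.mk.inj hk
    rfl
  rcases hadded with ⟨hsub, hcard⟩ | hsub
  · obtain ⟨⟨s, t⟩, rfl⟩ := Finset.card_eq_one.mp hcard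
    obtain ⟨-, ht, -, hs⟩ :=
      Finset.mem_filter.mp (hsub (Finset.mem_singleton_self _))
    obtain rfl : t = 0 := ht
    refine genericallyLocallyIdentifiable_of_incoming (s := s) hcyc ?_ ?_ (fun i j h => ?_)
      hin hout hleak
    · intro h
      have hv : ((s + 1 : Fin (m + 1)) : ℕ) = s + 1 :=
        Fin.val_add_one_of_lt (Fin.lt_def.mpr (by simpa using hs))
      rw [h] at hv
      simp at hv
    · rw [hedges]
      exact Finset.mem_union_right _ (Finset.mem_singleton_self _)
    · exact (hE i j h).imp_left fun h => Prod.mk.inj (Finset.mem_singleton.mp h)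
  · exact genericallyLocallyIdentifiable_of_outgoing hcyc
      (fun i j h => (hE i j h).imp_left fun h => (Finset.mem_filter.mp (hsub h)).2.1)
      hin hout hleak

end LinearCompartmentalModel

theorem mainTheorem5 (n : ℕ) [NeZero n] (hn : 3 ≤ n) (added : Finset (Fin n × Fin n))
    (hadded : (added ⊆ incomingEdges n ∧ added.card = 1) ∨
      (added ⊆ outgoingEdges n ∧ (added.card = 1 ∨ (4 ≤ n ∧ added.card = 2))))
    (M : LinearCompartmentalModel n)
    (hedges : M.edges = cycleEdges n ∪ added)
    (hin : M.inputs = {0}) (hout : M.outputs = {0}) (hleak : M.leaks.card = 1) :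
    M.GenericallyLocallyIdentifiable ∧ M.removeLeaks.GenericallyLocallyIdentifiable := by
  have hadded := hadded.imp_right And.left
  exact ⟨LinearCompartmentalModel.genericallyLocallyIdentifiable_of_cycle_union hadded hedges
      hin hout hleak.le,
    LinearCompartmentalModel.genericallyLocallyIdentifiable_of_cycle_union (M := M.removeLeaks)
      hadded hedges hin hout (by simp [LinearCompartmentalModel.removeLeaks])⟩
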